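/- For probability measures $\mu,\nu$ on $\mathbb{R}$, let $W_2(\mu,\nu)=\bigl(\inf\{\mathbb{E}(|X-Y|^2) : X\sim\mu,\ Y\sim\nu\}\bigr)^{1/2}$ be the Wasserstein distance of order $2$, where the infimum is over all pairs $(X,Y)$ of real random variables, defined on a common probability space, with marginal laws $\mu$ and $\nu$. Let $(\Pi(t))_{t\ge 0}$ be a Poisson process with parameter $1$. For any real $m>0$ and any real $\alpha\neq 0$, denote by $\mu_{m,\alpha}$ the law of $\alpha\bigl(\Pi(\alpha^{-2}m)-\alpha^{-2}m\bigr)$ and by $\nu_m$ the normal law $\mathcal{N}(0,m)$ with mean $0$ and variance $m$. Then $$W_2^2(\mu_{m,\alpha},\nu_m)\le 0.937\,\alpha^2 .$$ -/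

import Mathlib

open MeasureTheory ProbabilityTheory
open scoped NNReal ENNReal

/-- The joint laws on `ℝ × ℝ` of pairs `(X, Y)` with `X ∼ μ` and `Y ∼ ν`. -/
def couplings (μ ν : Measure ℝ) : Set (Measure (ℝ × ℝ)) :=
  {π | π.map Prod.fst = μ ∧ π.map Prod.snd = ν}

/-- The transport cost `κ_ψ(μ, ν) = inf {E ψ(X - Y) : X ∼ μ, Y ∼ ν}` of a non-negative function
`ψ`, with values in `[0, ∞]`. -/
noncomputable def transportCost (ψ : ℝ → ℝ) (μ ν : Measure ℝ) : ℝ≥0∞ :=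
  ⨅ π ∈ couplings μ ν, ∫⁻ z, ENNReal.ofReal (ψ (z.1 - z.2)) ∂π

/-- The Wasserstein distance `W_p = κ_p ^ (1 / p)`, where `κ_p` is the transport cost of
`x ↦ |x| ^ p`. -/
noncomputable def wassersteinDist (p : ℝ) (μ ν : Measure ℝ) : ℝ≥0∞ :=
  transportCost (fun x ↦ |x| ^ p) μ ν ^ (1 / p)

/-- `N` is a (homogeneous) Poisson process with parameter `r` under `P`: it starts from `0`, has
independent increments, its increment over `]s, t]` has the Poisson law of parameter `r (t - s)`,
and almost all of its paths are nondecreasing and right-continuous. (Monotonicity of the paths makes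
the truncated subtraction of natural numbers in the increments the true one almost surely.) -/
structure IsPoissonProcess {Ω : Type*} [MeasurableSpace Ω] (r : ℝ≥0) (N : ℝ≥0 → Ω → ℕ)
    (P : Measure Ω) : Prop where
  zero : ∀ᵐ ω ∂P, N 0 ω = 0
  indep : HasIndepIncrements N P
  law : ∀ s t : ℝ≥0, s ≤ t → HasLaw (fun ω ↦ N t ω - N s ω) (poissonMeasure (r * (t - s))) P
  mono : ∀ᵐ ω ∂P, Monotone fun t ↦ N t ω
  rightCont : ∀ᵐ ω ∂P, ∀ t, ContinuousWithinAt (fun u ↦ N u ω) (Set.Ici t) t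

/-! By scaling, it suffices to couple N - r, with N Poisson of parameter r = m / α², to a normal
variable of variance r at quadratic cost at most 0.937. Let U be uniform on [0, 1[ and independent
of N, let W = N + U and c = E W = r + 1/2, and let T be the increasing map sending the law of W to
N(0, r). The coupling is (N - r, T(W)).

Expanding, E (W - c - T(W))² = (r + 1/12) + r - 2 E T(W)(W - c), so the covariance must be bounded
from below. Let τ be the Stein kernel of W, explicit here. Integrating by parts against the law of W
gives, formally, E T(W)(W - c) = E τ(W) T'(W); integrating by parts on the Gaussian side, with T⁻¹
as test function, gives r E 1/T'(W). The sum of the two is 2 E T(W)(W - c) = E (τ T' + r / T'), and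
the integrand is at least 2√(rτ) ≥ r + τ - (τ - r)² / r (`kernelCost_le`). The last expression
involves only the first two moments of τ(W), and yields E (W - c - T(W))² ≤ 1/3 + 1/(120 r)
(`integral_sub_gaussianTransport_sq_le`).

The identity is used only as an inequality on compact intervals (`sub_transportPotential_le`), with
boundary terms absorbed by the tails of the covariance (`neg_le_transportPotential`,
`transportPotential_le`); neither τ T' + r / T' has to be integrable nor the boundary terms to
vanish.

Removing U - 1/2 costs a factor 2 and gives 5/6 + 1/(60 r) (`integral_coupling_cost_le`). For small
r the trivial bound 2 r takes over (`integral_coupling_cost_le_two_mul`). -/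

/-! ### Poisson weights and moments -/

/-- The mass which the Poisson law of parameter `r` gives to `n`. -/
noncomputable def poissonWeight (r : ℝ≥0) (n : ℕ) : ℝ :=
  Real.exp (-r) * (r : ℝ) ^ n / (n.factorial : ℝ)

lemma poissonWeight_pos {r : ℝ≥0} (hr : 0 < r) (n : ℕ) : 0 < poissonWeight r n := by
  have : (0 : ℝ) < r := hr
  unfold poissonWeight
  positivity

lemma poissonWeight_nonneg (r : ℝ≥0) (n : ℕ) : 0 ≤ poissonWeight r n := by
  unfold poissonWeight
  positivity

lemma succ_mul_poissonWeight_succ (r : ℝ≥0) (n : ℕ) :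
    ((n : ℝ) + 1) * poissonWeight r (n + 1) = r * poissonWeight r n := by
  unfold poissonWeight
  rw [Nat.factorial_succ]
  have : (n.factorial : ℝ) ≠ 0 := by positivity
  push_cast
  field_simp
  ring

lemma hasSum_poissonWeight (r : ℝ≥0) : HasSum (poissonWeight r) 1 :=
  hasSum_one_poissonMeasure r

lemma hasSum_nat_mul_poissonWeight (r : ℝ≥0) :
    HasSum (fun n : ℕ ↦ (n : ℝ) * poissonWeight r n) r := by
  rw [← hasSum_nat_add_iff' 1]
  have h := (hasSum_poissonWeight r).mul_left (r : ℝ)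
  simp only [mul_one] at h
  simpa [succ_mul_poissonWeight_succ] using h

lemma hasSum_sq_mul_poissonWeight (r : ℝ≥0) :
    HasSum (fun n : ℕ ↦ (n : ℝ) ^ 2 * poissonWeight r n) ((r : ℝ) ^ 2 + r) := by
  rw [← hasSum_nat_add_iff' 1]
  have h := ((hasSum_nat_mul_poissonWeight r).mul_left (r : ℝ)).add
    ((hasSum_poissonWeight r).mul_left (r : ℝ))
  have e : (fun n : ℕ ↦ (((n + 1 : ℕ) : ℝ)) ^ 2 * poissonWeight r (n + 1)) =
      fun n : ℕ ↦ (r : ℝ) * ((n : ℝ) * poissonWeight r n) + r * poissonWeight r n := by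
    ext n
    push_cast
    linear_combination ((n : ℝ) + 1) * succ_mul_poissonWeight_succ r n
  have e' : (r : ℝ) ^ 2 + r - ∑ i ∈ Finset.range 1, (i : ℝ) ^ 2 * poissonWeight r i =
      r * r + r * 1 := by
    rw [Finset.sum_range_one]
    push_cast
    ring
  rw [e, e']
  exact h

lemma integrable_sq_poissonMeasure (r : ℝ≥0) :
    Integrable (fun n : ℕ ↦ (n : ℝ) ^ 2) (poissonMeasure r) := by
  rw [integrable_poissonMeasure_iff]
  convert (hasSum_sq_mul_poissonWeight r).summable using 2 with n
  rw [Real.norm_of_nonneg (by positivity), mul_comm]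
  rfl

lemma memLp_natCast_poissonMeasure (r : ℝ≥0) :
    MemLp (fun n : ℕ ↦ (n : ℝ)) 2 (poissonMeasure r) :=
  (memLp_two_iff_integrable_sq .of_discrete).2 (integrable_sq_poissonMeasure r)

lemma integral_natCast_poissonMeasure (r : ℝ≥0) : ∫ n : ℕ, (n : ℝ) ∂poissonMeasure r = r := by
  rw [integral_poissonMeasure]
  refine Eq.trans (tsum_congr fun n ↦ ?_) (hasSum_nat_mul_poissonWeight r).tsum_eq
  rw [smul_eq_mul, mul_comm, poissonWeight]

lemma integral_natCast_sq_poissonMeasure (r : ℝ≥0) :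
    ∫ n : ℕ, (n : ℝ) ^ 2 ∂poissonMeasure r = (r : ℝ) ^ 2 + r := by
  rw [integral_poissonMeasure]
  refine Eq.trans (tsum_congr fun n ↦ ?_) (hasSum_sq_mul_poissonWeight r).tsum_eq
  rw [smul_eq_mul, mul_comm, poissonWeight]

/-! ### Smoothing by a uniform variable: density and distribution function -/

instance : IsProbabilityMeasure (volume.restrict (Set.Ico (0 : ℝ) 1)) := ⟨by simp⟩

/-- The law of an independent pair of a Poisson variable and a uniform variable on `[0, 1[`. -/
noncomputable def poissonUniform (r : ℝ≥0) : Measure (ℕ × ℝ) :=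
  (poissonMeasure r).prod (volume.restrict (Set.Ico (0 : ℝ) 1))

instance (r : ℝ≥0) : IsProbabilityMeasure (poissonUniform r) := by
  unfold poissonUniform; infer_instance

/-- The law of the sum of independent Poisson and uniform variables. -/
noncomputable def smoothedPoisson (r : ℝ≥0) : Measure ℝ :=
  (poissonUniform r).map fun z ↦ (z.1 : ℝ) + z.2

lemma measurable_natCast_add : Measurable fun z : ℕ × ℝ ↦ (z.1 : ℝ) + z.2 := by
  fun_prop

instance (r : ℝ≥0) : IsProbabilityMeasure (smoothedPoisson r) :=
  Measure.isProbabilityMeasure_map measurable_natCast_add.aemeasurable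

lemma measurable_poissonWeight_floor (r : ℝ≥0) :
    Measurable fun x : ℝ ↦ poissonWeight r ⌊x⌋₊ :=
  (Measurable.of_discrete (f := poissonWeight r)).comp Nat.measurable_floor

lemma iUnion_Ico_natCast : ⋃ n : ℕ, Set.Ico (n : ℝ) (n + 1) = Set.Ici 0 := by
  ext x
  simp only [Set.mem_iUnion, Set.mem_Ico, Set.mem_Ici]
  exact ⟨fun ⟨n, h, _⟩ ↦ (Nat.cast_nonneg n).trans h,
    fun h ↦ ⟨⌊x⌋₊, Nat.floor_le h, Nat.lt_floor_add_one x⟩⟩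

lemma pairwise_disjoint_Ico_natCast :
    Pairwise (Function.onFun Disjoint fun n : ℕ ↦ Set.Ico (n : ℝ) (n + 1)) := by
  intro m n hmn
  rw [Function.onFun, Set.disjoint_left]
  rintro x ⟨h1, h2⟩ ⟨h3, h4⟩
  apply hmn
  have a : (m : ℝ) < n + 1 := h1.trans_lt h4
  have b : (n : ℝ) < m + 1 := h3.trans_lt h2
  norm_cast at a b
  omega

lemma lintegral_poissonUniform (r : ℝ≥0) {f : ℕ × ℝ → ℝ≥0∞} (hf : Measurable f) :
    ∫⁻ z, f z ∂poissonUniform r =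
      ∑' n : ℕ, ENNReal.ofReal (poissonWeight r n) * ∫⁻ u in Set.Ico (0 : ℝ) 1, f (n, u) := by
  rw [poissonUniform, lintegral_prod _ hf.aemeasurable]
  conv_lhs => rw [poissonMeasure]
  rw [lintegral_sum_measure]
  simp only [lintegral_smul_measure, lintegral_dirac, smul_eq_mul]
  rfl

lemma smoothedPoisson_eq_withDensity (r : ℝ≥0) :
    smoothedPoisson r = (volume.restrict (Set.Ici 0)).withDensity
      fun x ↦ ENNReal.ofReal (poissonWeight r ⌊x⌋₊) := by
  ext s hs
  rw [smoothedPoisson, Measure.map_apply measurable_natCast_add hs,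
    withDensity_apply _ hs, ← lintegral_indicator_one (measurable_natCast_add hs),
    lintegral_poissonUniform _ (measurable_one.indicator (measurable_natCast_add hs)),
    ← lintegral_indicator hs, ← iUnion_Ico_natCast,
    lintegral_iUnion (fun _ ↦ measurableSet_Ico) pairwise_disjoint_Ico_natCast]
  refine tsum_congr fun n ↦ ?_
  have e : ∫⁻ x in Set.Ico (n : ℝ) (n + 1), s.indicator
        (fun x ↦ ENNReal.ofReal (poissonWeight r ⌊x⌋₊)) x =
      ∫⁻ x in Set.Ico (n : ℝ) (n + 1), ENNReal.ofReal (poissonWeight r n) * s.indicator 1 x := by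
    refine setLIntegral_congr_fun measurableSet_Ico fun x hx ↦ ?_
    have : ⌊x⌋₊ = n := (Nat.floor_eq_iff ((Nat.cast_nonneg n).trans hx.1)).2 hx
    by_cases h : x ∈ s <;> simp [h, this]
  rw [e, lintegral_const_mul _ (measurable_one.indicator hs)]
  congr 1
  have h := (measurePreserving_add_left (volume : Measure ℝ) (n : ℝ)).setLIntegral_comp_preimage_emb
    (MeasurableEquiv.addLeft (n : ℝ)).measurableEmbedding (s.indicator 1) (Set.Ico (n : ℝ) (n + 1))
  rw [← h]
  simp only [Set.preimage_const_add_Ico, sub_self, add_sub_cancel_left]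
  rfl

lemma setIntegral_smoothedPoisson (r : ℝ≥0) {a b : ℝ} (ha : 0 ≤ a) (hab : a ≤ b) (g : ℝ → ℝ) :
    ∫ x in Set.Ioc a b, g x ∂smoothedPoisson r = ∫ x in a..b, poissonWeight r ⌊x⌋₊ * g x := by
  rw [smoothedPoisson_eq_withDensity,
    setIntegral_withDensity_eq_setIntegral_toReal_smul
      (measurable_poissonWeight_floor r).ennreal_ofReal (by simp) _ measurableSet_Ioc,
    Measure.restrict_restrict measurableSet_Ioc, intervalIntegral.integral_of_le hab,
    Set.inter_eq_left.2 (fun x hx ↦ Set.mem_Ici.2 (ha.trans hx.1.le))]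
  simp [ENNReal.toReal_ofReal (poissonWeight_nonneg _ _)]

lemma ae_pos_smoothedPoisson (r : ℝ≥0) : ∀ᵐ x ∂smoothedPoisson r, 0 < x := by
  rw [smoothedPoisson_eq_withDensity]
  apply (withDensity_absolutelyContinuous _ _).ae_le
  rw [← restrict_Ioi_eq_restrict_Ici]
  exact ae_restrict_mem measurableSet_Ioi

open Filter Set in
lemma floor_eventuallyEq_nhdsGE {x : ℝ} (hx : 0 ≤ x) : ∀ᶠ t in nhdsWithin x (Ici x), ⌊t⌋₊ = ⌊x⌋₊ := by
  filter_upwards [Ico_mem_nhdsGE (Nat.lt_floor_add_one x)] with t ht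
  exact (Nat.floor_eq_iff (hx.trans ht.1)).2 ⟨(Nat.floor_le hx).trans ht.1, ht.2⟩

lemma poissonWeight_le_one (r : ℝ≥0) (n : ℕ) : poissonWeight r n ≤ 1 :=
  le_hasSum (hasSum_poissonWeight r) n fun m _ ↦ poissonWeight_nonneg r m

lemma intervalIntegrable_poissonWeight_floor (r : ℝ≥0) (a b : ℝ) :
    IntervalIntegrable (fun x : ℝ ↦ poissonWeight r ⌊x⌋₊) volume a b := by
  refine (intervalIntegrable_const (c := (1 : ℝ))).mono_fun
    (measurable_poissonWeight_floor r).aestronglyMeasurable (Filter.Eventually.of_forall fun x ↦ ?_)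
  simpa [abs_of_nonneg (poissonWeight_nonneg _ _)] using poissonWeight_le_one r _

lemma intervalIntegrable_poissonWeight_floor_mul (r : ℝ≥0) {g : ℝ → ℝ} (hg : Continuous g)
    (a b : ℝ) : IntervalIntegrable (fun x ↦ poissonWeight r ⌊x⌋₊ * g x) volume a b :=
  (intervalIntegrable_poissonWeight_floor r a b).mul_continuousOn hg.continuousOn

lemma continuous_primitive_poissonWeight (r : ℝ≥0) {g : ℝ → ℝ} (hg : Continuous g) :
    Continuous fun x ↦ ∫ t in (0 : ℝ)..x, poissonWeight r ⌊t⌋₊ * g t :=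
  intervalIntegral.continuous_primitive (intervalIntegrable_poissonWeight_floor_mul r hg) 0

/-- The density jumps at integers but is right-continuous, so right derivatives exist at every
point. They are all that the mean value inequality in `sub_transportPotential_le` requires. -/
lemma hasDerivWithinAt_primitive_poissonWeight (r : ℝ≥0) {g : ℝ → ℝ} (hg : Continuous g) {x : ℝ}
    (hx : 0 ≤ x) :
    HasDerivWithinAt (fun x ↦ ∫ t in (0 : ℝ)..x, poissonWeight r ⌊t⌋₊ * g t)
      (poissonWeight r ⌊x⌋₊ * g x) (Set.Ioi x) x := by
  refine (intervalIntegral.integral_hasDerivWithinAt_right (s := Set.Ici x) (t := Set.Ioi x)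
    (intervalIntegrable_poissonWeight_floor_mul r hg 0 x) ?_ ?_).mono Set.Ioi_subset_Ici_self
  · exact ((measurable_poissonWeight_floor r).mul hg.measurable).stronglyMeasurable.stronglyMeasurableAtFilter
  · refine ContinuousWithinAt.mono ?_ Set.Ioi_subset_Ici_self
    refine ContinuousWithinAt.mul ?_ hg.continuousWithinAt
    refine continuousWithinAt_const.congr_of_eventuallyEq (f := fun _ ↦ poissonWeight r ⌊x⌋₊) ?_ rfl
    filter_upwards [floor_eventuallyEq_nhdsGE hx] with t ht
    rw [ht]

lemma cdf_smoothedPoisson (r : ℝ≥0) {x : ℝ} (hx : 0 ≤ x) :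
    cdf (smoothedPoisson r) x = ∫ t in (0 : ℝ)..x, poissonWeight r ⌊t⌋₊ * 1 := by
  rw [cdf_eq_real, ← setIntegral_smoothedPoisson r le_rfl hx]
  rw [setIntegral_const, smul_eq_mul, mul_one]
  refine measureReal_congr ?_
  filter_upwards [ae_pos_smoothedPoisson r] with t ht
  simp only [eq_iff_iff]
  exact ⟨fun h ↦ ⟨ht, h⟩, fun h ↦ h.2⟩

lemma continuousOn_cdf_smoothedPoisson (r : ℝ≥0) :
    ContinuousOn (cdf (smoothedPoisson r)) (Set.Ici 0) :=
  (continuous_primitive_poissonWeight r continuous_const).continuousOn.congr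
    fun _ hx ↦ cdf_smoothedPoisson r hx

lemma hasDerivWithinAt_cdf_smoothedPoisson (r : ℝ≥0) {x : ℝ} (hx : 0 ≤ x) :
    HasDerivWithinAt (cdf (smoothedPoisson r)) (poissonWeight r ⌊x⌋₊) (Set.Ioi x) x := by
  have h := hasDerivWithinAt_primitive_poissonWeight r (continuous_const (y := (1 : ℝ))) hx
  rw [mul_one] at h
  exact h.congr (fun t ht ↦ cdf_smoothedPoisson r (hx.trans (Set.mem_Ioi.1 ht).le))
    (cdf_smoothedPoisson r hx)

lemma strictMonoOn_cdf_smoothedPoisson {r : ℝ≥0} (hr : 0 < r) :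
    StrictMonoOn (cdf (smoothedPoisson r)) (Set.Ici 0) := by
  intro a ha b hb hab
  have hi := intervalIntegrable_poissonWeight_floor_mul r (continuous_const (y := (1 : ℝ)))
  rw [cdf_smoothedPoisson r ha, cdf_smoothedPoisson r hb, ← sub_pos,
    intervalIntegral.integral_interval_sub_left (hi _ _) (hi _ _)]
  exact intervalIntegral.intervalIntegral_pos_of_pos (hi _ _)
    (fun x ↦ mul_pos (poissonWeight_pos hr _) one_pos) hab

lemma cdf_smoothedPoisson_zero (r : ℝ≥0) : cdf (smoothedPoisson r) 0 = 0 := by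
  rw [cdf_smoothedPoisson r le_rfl, intervalIntegral.integral_same]

lemma cdf_smoothedPoisson_mem_Ioo {r : ℝ≥0} (hr : 0 < r) {x : ℝ} (hx : 0 < x) :
    cdf (smoothedPoisson r) x ∈ Set.Ioo (0 : ℝ) 1 := by
  have h := strictMonoOn_cdf_smoothedPoisson hr
  refine ⟨?_, ?_⟩
  · rw [← cdf_smoothedPoisson_zero r]
    exact h Set.self_mem_Ici hx.le hx
  · exact (h hx.le (hx.trans (lt_add_one x)).le (lt_add_one x)).trans_le (cdf_le_one _ _)

lemma exists_cdf_smoothedPoisson_eq (r : ℝ≥0) {u : ℝ} (hu : u ∈ Set.Ioo (0 : ℝ) 1) :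
    ∃ x, 0 < x ∧ cdf (smoothedPoisson r) x = u := by
  obtain ⟨b, hb, hb0⟩ := (((tendsto_cdf_atTop (smoothedPoisson r)).eventually
    (lt_mem_nhds hu.2)).and (Filter.eventually_ge_atTop 0)).exists
  obtain ⟨x, hx, hxu⟩ := intermediate_value_Icc hb0
    ((continuousOn_cdf_smoothedPoisson r).mono Set.Icc_subset_Ici_self)
    (show u ∈ Set.Icc _ _ by rw [cdf_smoothedPoisson_zero]; exact ⟨hu.1.le, hb.le⟩)
  refine ⟨x, lt_of_le_of_ne hx.1 ?_, hxu⟩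
  rintro rfl
  rw [cdf_smoothedPoisson_zero] at hxu
  exact hu.1.ne hxu

/-! ### Density and distribution function of the centered normal law -/

section Gaussian

variable {v : ℝ≥0} (hv : v ≠ 0)
include hv

lemma hasDerivAt_gaussianPDFReal (y : ℝ) :
    HasDerivAt (gaussianPDFReal 0 v) (-(y / v) * gaussianPDFReal 0 v y) y := by
  have hv' : (v : ℝ) ≠ 0 := by exact_mod_cast hv
  rw [gaussianPDFReal_def]
  have h : HasDerivAt (fun x : ℝ ↦ -(x - 0) ^ 2 / (2 * v)) (-(y / v)) y := by
    have := (((hasDerivAt_id y).sub_const 0).pow 2).neg.div_const (2 * (v : ℝ))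
    convert! this using 1
    simp
    field_simp
  convert! h.exp.const_mul (√(2 * Real.pi * v))⁻¹ using 1
  ring

lemma continuous_gaussianPDFReal : Continuous (gaussianPDFReal 0 v) :=
  continuous_iff_continuousAt.2 fun y ↦ (hasDerivAt_gaussianPDFReal hv y).continuousAt

lemma tendsto_gaussianPDFReal_atTop :
    Filter.Tendsto (gaussianPDFReal 0 v) Filter.atTop (nhds 0) := by
  have hv' : (0 : ℝ) < v := by exact_mod_cast pos_iff_ne_zero.2 hv
  rw [gaussianPDFReal_def]
  have h : Filter.Tendsto (fun x : ℝ ↦ -(x - 0) ^ 2 / (2 * v)) Filter.atTop Filter.atBot := by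
    simp only [sub_zero, neg_div]
    exact Filter.tendsto_neg_atTop_atBot.comp
      ((Filter.tendsto_pow_atTop two_ne_zero).atTop_div_const (by positivity))
  simpa using (Real.tendsto_exp_atBot.comp h).const_mul (√(2 * Real.pi * v))⁻¹

lemma cdf_gaussianReal_eq_integral (y : ℝ) :
    cdf (gaussianReal 0 v) y = ∫ x in Set.Iic y, gaussianPDFReal 0 v x := by
  rw [cdf_eq_real, measureReal_def, gaussianReal_apply_eq_integral _ hv, ENNReal.toReal_ofReal]
  exact integral_nonneg fun _ ↦ gaussianPDFReal_nonneg _ _ _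

lemma hasDerivAt_cdf_gaussianReal (y : ℝ) :
    HasDerivAt (cdf (gaussianReal 0 v)) (gaussianPDFReal 0 v y) y := by
  have hi := integrable_gaussianPDFReal 0 v
  have e : (cdf (gaussianReal 0 v) : ℝ → ℝ) = fun y ↦ (∫ x in Set.Iic 0, gaussianPDFReal 0 v x) +
      ∫ x in (0 : ℝ)..y, gaussianPDFReal 0 v x := by
    ext y
    rw [cdf_gaussianReal_eq_integral hv,
      ← intervalIntegral.integral_Iic_sub_Iic hi.integrableOn hi.integrableOn]
    ring
  rw [e]
  exact ((continuous_gaussianPDFReal hv).integral_hasStrictDerivAt 0 y).hasDerivAt.const_add _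

lemma continuous_cdf_gaussianReal : Continuous (cdf (gaussianReal 0 v)) :=
  continuous_iff_continuousAt.2 fun y ↦ (hasDerivAt_cdf_gaussianReal hv y).continuousAt

lemma strictMono_cdf_gaussianReal : StrictMono (cdf (gaussianReal 0 v)) :=
  strictMono_of_deriv_pos fun y ↦ by
    rw [(hasDerivAt_cdf_gaussianReal hv y).deriv]
    exact gaussianPDFReal_pos _ _ _ hv

lemma cdf_gaussianReal_mem_Ioo (y : ℝ) : cdf (gaussianReal 0 v) y ∈ Set.Ioo (0 : ℝ) 1 :=
  ⟨(cdf_nonneg _ (y - 1)).trans_lt (strictMono_cdf_gaussianReal hv (sub_one_lt y)),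
    (strictMono_cdf_gaussianReal hv (lt_add_one y)).trans_le (cdf_le_one _ _)⟩

lemma exists_cdf_gaussianReal_eq {u : ℝ} (hu : u ∈ Set.Ioo (0 : ℝ) 1) :
    ∃ y, cdf (gaussianReal 0 v) y = u :=
  mem_range_of_exists_le_of_exists_ge (continuous_cdf_gaussianReal hv)
    (((tendsto_cdf_atBot _).eventually (gt_mem_nhds hu.1)).exists.imp fun _ h ↦ h.le)
    (((tendsto_cdf_atTop _).eventually (lt_mem_nhds hu.2)).exists.imp fun _ h ↦ h.le)

end Gaussian

/-! ### The monotone transport map -/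

/-- The nondecreasing map which transports `smoothedPoisson r` to the centered normal law of
variance `r`. -/
noncomputable def gaussianTransport (r : ℝ≥0) (x : ℝ) : ℝ :=
  Function.invFun (cdf (gaussianReal 0 r)) (cdf (smoothedPoisson r) x)

section Transport

variable {r : ℝ≥0} (hr : 0 < r)
include hr

lemma cdf_gaussianTransport {x : ℝ} (hx : 0 < x) :
    cdf (gaussianReal 0 r) (gaussianTransport r x) = cdf (smoothedPoisson r) x :=
  Function.invFun_eq (exists_cdf_gaussianReal_eq hr.ne' (cdf_smoothedPoisson_mem_Ioo hr hx))

lemma strictMonoOn_gaussianTransport : StrictMonoOn (gaussianTransport r) (Set.Ioi 0) := by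
  intro a ha b hb hab
  rw [← (strictMono_cdf_gaussianReal hr.ne').lt_iff_lt, cdf_gaussianTransport hr ha,
    cdf_gaussianTransport hr hb]
  exact strictMonoOn_cdf_smoothedPoisson hr (Set.mem_Ioi.1 ha).le (Set.mem_Ioi.1 hb).le hab

lemma exists_gaussianTransport_eq (y : ℝ) : ∃ x, 0 < x ∧ gaussianTransport r x = y := by
  obtain ⟨x, hx, hxy⟩ := exists_cdf_smoothedPoisson_eq r (cdf_gaussianReal_mem_Ioo hr.ne' y)
  refine ⟨x, hx, (strictMono_cdf_gaussianReal hr.ne').injective ?_⟩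
  rw [cdf_gaussianTransport hr hx, hxy]

lemma continuousOn_gaussianTransport : ContinuousOn (gaussianTransport r) (Set.Ioi 0) := by
  intro x hx
  refine ContinuousAt.continuousWithinAt (continuousAt_of_monotoneOn_of_image_mem_nhds
    (strictMonoOn_gaussianTransport hr).monotoneOn (Ioi_mem_nhds hx) ?_)
  convert! Filter.univ_mem
  exact Set.eq_univ_of_forall fun y ↦ exists_gaussianTransport_eq hr y

/-- Chain rule for the Gaussian quantile function composed with the distribution function of W. The
value is the change of variables formula φ(T) T' = w. -/
lemma hasDerivWithinAt_gaussianTransport {x : ℝ} (hx : 0 < x) :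
    HasDerivWithinAt (gaussianTransport r)
      (poissonWeight r ⌊x⌋₊ / gaussianPDFReal 0 r (gaussianTransport r x)) (Set.Ioi x) x := by
  -- The quantile function is monotone on ]0, 1[ and takes every real value there, hence has no
  -- jump.
  have hc : ContinuousAt (Function.invFun (cdf (gaussianReal 0 r))) (cdf (smoothedPoisson r) x) := by
    have hinv : ∀ u ∈ Set.Ioo (0 : ℝ) 1,
        cdf (gaussianReal 0 r) (Function.invFun (cdf (gaussianReal 0 r)) u) = u :=
      fun u hu ↦ Function.invFun_eq (exists_cdf_gaussianReal_eq hr.ne' hu)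
    have hm := cdf_smoothedPoisson_mem_Ioo hr hx
    refine continuousAt_of_monotoneOn_of_image_mem_nhds (s := Set.Ioo 0 1) ?_
      (Ioo_mem_nhds hm.1 hm.2) ?_
    · intro a ha b hb hab
      rwa [← (strictMono_cdf_gaussianReal hr.ne').le_iff_le, hinv a ha, hinv b hb]
    · convert! Filter.univ_mem
      refine Set.eq_univ_of_forall fun y ↦ ⟨_, cdf_gaussianReal_mem_Ioo hr.ne' y, ?_⟩
      exact Function.leftInverse_invFun (strictMono_cdf_gaussianReal hr.ne').injective y
  have hd := HasDerivAt.of_local_left_inverse hc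
    (hasDerivAt_cdf_gaussianReal hr.ne' _) (gaussianPDFReal_pos _ _ _ hr.ne').ne' (by
      have hm := cdf_smoothedPoisson_mem_Ioo hr hx
      filter_upwards [Ioo_mem_nhds hm.1 hm.2] with u hu
      exact Function.invFun_eq (exists_cdf_gaussianReal_eq hr.ne' hu))
  convert! hd.comp_hasDerivWithinAt x (hasDerivWithinAt_cdf_smoothedPoisson r hx.le) using 1
  rw [div_eq_inv_mul]
  rfl

lemma aemeasurable_gaussianTransport :
    AEMeasurable (gaussianTransport r) (smoothedPoisson r) := by
  have h : AEMeasurable (gaussianTransport r) ((smoothedPoisson r).restrict (Set.Ioi 0)) :=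
    (continuousOn_gaussianTransport hr).aemeasurable measurableSet_Ioi
  have e : (smoothedPoisson r).restrict (Set.Ioi 0) = smoothedPoisson r :=
    Measure.restrict_eq_self_of_ae_mem (ae_pos_smoothedPoisson r)
  rwa [e] at h

lemma map_gaussianTransport : (smoothedPoisson r).map (gaussianTransport r) = gaussianReal 0 r := by
  have hm := aemeasurable_gaussianTransport hr
  have := Measure.isProbabilityMeasure_map hm
  refine Measure.eq_of_cdf _ _ ?_
  ext y
  obtain ⟨x, hx, rfl⟩ := exists_gaussianTransport_eq hr y
  rw [cdf_gaussianTransport hr hx, cdf_eq_real, cdf_eq_real,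
    map_measureReal_apply_of_aemeasurable hm measurableSet_Iic]
  refine measureReal_congr ?_
  filter_upwards [ae_pos_smoothedPoisson r] with t ht
  exact propext ((strictMonoOn_gaussianTransport hr).le_iff_le ht hx)

end Transport

/-! ### Moments of W and of its Stein kernel -/

section Moments

variable (r : ℝ≥0)

lemma ae_snd_mem_Ico_poissonUniform : ∀ᵐ z ∂poissonUniform r, z.2 ∈ Set.Ico (0 : ℝ) 1 := by
  have h : ∀ᵐ u ∂volume.restrict (Set.Ico (0 : ℝ) 1), u ∈ Set.Ico (0 : ℝ) 1 :=
    ae_restrict_mem measurableSet_Ico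
  exact Measure.quasiMeasurePreserving_snd.ae h

lemma memLp_fst_poissonUniform : MemLp (fun z : ℕ × ℝ ↦ (z.1 : ℝ)) 2 (poissonUniform r) :=
  (memLp_natCast_poissonMeasure r).comp_measurePreserving measurePreserving_fst

lemma memLp_snd_poissonUniform {g : ℝ → ℝ} (hg : Measurable g) {C : ℝ}
    (hC : ∀ u ∈ Set.Ico (0 : ℝ) 1, |g u| ≤ C) {p : ℝ≥0∞} :
    MemLp (fun z : ℕ × ℝ ↦ g z.2) p (poissonUniform r) := by
  refine MemLp.of_bound (hg.comp measurable_snd).aestronglyMeasurable C ?_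
  filter_upwards [ae_snd_mem_Ico_poissonUniform r] with z hz
  exact hC _ hz

lemma integral_fst_mul_snd_poissonUniform (f : ℕ → ℝ) (g : ℝ → ℝ) :
    ∫ z, f z.1 * g z.2 ∂poissonUniform r =
      (∫ n, f n ∂poissonMeasure r) * ∫ u in (0 : ℝ)..1, g u := by
  rw [poissonUniform, integral_prod_mul, integral_Ico_eq_integral_Ioc,
    intervalIntegral.integral_of_le zero_le_one]

lemma integrable_fst_mul_snd_poissonUniform {f : ℕ → ℝ} (hf : Integrable f (poissonMeasure r))
    {g : ℝ → ℝ} (hg : Continuous g) :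
    Integrable (fun z : ℕ × ℝ ↦ f z.1 * g z.2) (poissonUniform r) :=
  hf.mul_prod ((hg.integrableOn_Icc (a := 0) (b := 1)).mono_set Set.Ico_subset_Icc_self)

lemma integrable_sub_poissonMeasure :
    Integrable (fun n : ℕ ↦ (n : ℝ) - r) (poissonMeasure r) :=
  ((memLp_natCast_poissonMeasure r).integrable one_le_two).sub (integrable_const _)

lemma integral_sub_poissonMeasure : ∫ n : ℕ, ((n : ℝ) - r) ∂poissonMeasure r = 0 := by
  rw [integral_sub ((memLp_natCast_poissonMeasure r).integrable one_le_two) (integrable_const _),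
    integral_natCast_poissonMeasure]
  simp

lemma integrable_sub_sq_poissonMeasure :
    Integrable (fun n : ℕ ↦ ((n : ℝ) - r) ^ 2) (poissonMeasure r) :=
  ((memLp_natCast_poissonMeasure r).sub (memLp_const _)).integrable_sq

lemma integral_sub_sq_poissonMeasure :
    ∫ n : ℕ, ((n : ℝ) - r) ^ 2 ∂poissonMeasure r = r := by
  have h1 := (integrable_sub_poissonMeasure r).const_mul (2 * (r : ℝ))
  have h2 : Integrable (fun n : ℕ ↦ (n : ℝ) ^ 2 - 2 * r * ((n : ℝ) - r)) (poissonMeasure r) :=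
    (integrable_sq_poissonMeasure r).sub h1
  have e : (fun n : ℕ ↦ ((n : ℝ) - r) ^ 2) =
      fun n : ℕ ↦ (n : ℝ) ^ 2 - 2 * r * ((n : ℝ) - r) - r ^ 2 := by
    ext n; ring
  rw [e, integral_sub h2 (integrable_const _), integral_sub (integrable_sq_poissonMeasure r) h1,
    integral_const_mul, integral_sub_poissonMeasure, integral_natCast_sq_poissonMeasure]
  simp

/-- The Stein kernel of the sum of independent Poisson and uniform variables, as a function of
these variables. -/
noncomputable def poissonUniformKernel (z : ℕ × ℝ) : ℝ :=
  (1 - z.2) * z.1 + r * z.2 + z.2 * (1 - z.2) / 2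

lemma poissonUniformKernel_sub (z : ℕ × ℝ) : poissonUniformKernel r z - r =
    ((z.1 : ℝ) - r) * (1 - z.2) + 1 * (z.2 * (1 - z.2) / 2) := by
  unfold poissonUniformKernel; ring

lemma integrable_poissonUniformKernel_sub :
    Integrable (fun z ↦ poissonUniformKernel r z - r) (poissonUniform r) := by
  simp only [poissonUniformKernel_sub]
  exact (integrable_fst_mul_snd_poissonUniform r (integrable_sub_poissonMeasure r)
    (by fun_prop : Continuous fun u : ℝ ↦ 1 - u)).add (integrable_fst_mul_snd_poissonUniform r
      (integrable_const 1) (by fun_prop : Continuous fun u : ℝ ↦ u * (1 - u) / 2))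

/-- The mean of a Stein kernel is the variance, here r + 1/12. -/
lemma integral_poissonUniformKernel_sub :
    ∫ z, (poissonUniformKernel r z - r) ∂poissonUniform r = 1 / 12 := by
  simp only [poissonUniformKernel_sub]
  rw [integral_add (integrable_fst_mul_snd_poissonUniform r (integrable_sub_poissonMeasure r)
      (by fun_prop : Continuous fun u : ℝ ↦ 1 - u)) (integrable_fst_mul_snd_poissonUniform r
      (integrable_const 1) (by fun_prop : Continuous fun u : ℝ ↦ u * (1 - u) / 2)),
    integral_fst_mul_snd_poissonUniform r (fun n ↦ (n : ℝ) - r) (fun u ↦ 1 - u),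
    integral_fst_mul_snd_poissonUniform r (fun _ ↦ 1) (fun u ↦ u * (1 - u) / 2),
    integral_sub_poissonMeasure]
  have e : (fun u : ℝ ↦ u * (1 - u) / 2) = fun u ↦ u * (1 / 2) - u ^ 2 * (1 / 2) := by
    ext u; ring
  rw [e, intervalIntegral.integral_sub (Continuous.intervalIntegrable (by fun_prop) _ _)
    (Continuous.intervalIntegrable (by fun_prop) _ _)]
  simp
  norm_num

lemma poissonUniformKernel_sub_sq (z : ℕ × ℝ) : (poissonUniformKernel r z - r) ^ 2 =
    ((z.1 : ℝ) - r) ^ 2 * (1 - z.2) ^ 2 + ((z.1 : ℝ) - r) * (z.2 * (1 - z.2) ^ 2) +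
      1 * (z.2 ^ 2 * (1 - z.2) ^ 2 / 4) := by
  unfold poissonUniformKernel; ring

lemma integrable_poissonUniformKernel_sub_sq :
    Integrable (fun z ↦ (poissonUniformKernel r z - r) ^ 2) (poissonUniform r) := by
  simp only [poissonUniformKernel_sub_sq]
  exact ((integrable_fst_mul_snd_poissonUniform r (integrable_sub_sq_poissonMeasure r)
    (by fun_prop : Continuous fun u : ℝ ↦ (1 - u) ^ 2)).add
    (integrable_fst_mul_snd_poissonUniform r (integrable_sub_poissonMeasure r)
      (by fun_prop : Continuous fun u : ℝ ↦ u * (1 - u) ^ 2))).add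
    (integrable_fst_mul_snd_poissonUniform r (integrable_const 1)
      (by fun_prop : Continuous fun u : ℝ ↦ u ^ 2 * (1 - u) ^ 2 / 4))

lemma integral_poissonUniformKernel_sub_sq :
    ∫ z, (poissonUniformKernel r z - r) ^ 2 ∂poissonUniform r = r / 3 + 1 / 120 := by
  have h1 := integrable_fst_mul_snd_poissonUniform r (integrable_sub_sq_poissonMeasure r)
    (by fun_prop : Continuous fun u : ℝ ↦ (1 - u) ^ 2)
  have h2 := integrable_fst_mul_snd_poissonUniform r (integrable_sub_poissonMeasure r)
    (by fun_prop : Continuous fun u : ℝ ↦ u * (1 - u) ^ 2)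
  have h3 := integrable_fst_mul_snd_poissonUniform r (integrable_const 1)
    (by fun_prop : Continuous fun u : ℝ ↦ u ^ 2 * (1 - u) ^ 2 / 4)
  simp only [poissonUniformKernel_sub_sq]
  rw [integral_add (h1.fun_add h2) h3, integral_add h1 h2,
    integral_fst_mul_snd_poissonUniform r (fun n ↦ ((n : ℝ) - r) ^ 2) (fun u ↦ (1 - u) ^ 2),
    integral_fst_mul_snd_poissonUniform r (fun n ↦ (n : ℝ) - r) (fun u ↦ u * (1 - u) ^ 2),
    integral_fst_mul_snd_poissonUniform r (fun _ ↦ 1) (fun u ↦ u ^ 2 * (1 - u) ^ 2 / 4),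
    integral_sub_poissonMeasure, integral_sub_sq_poissonMeasure]
  have e1 : ∫ u in (0 : ℝ)..1, (1 - u) ^ 2 = 1 / 3 := by
    rw [intervalIntegral.integral_comp_sub_left (fun u ↦ u ^ 2) (1 : ℝ), integral_pow]
    norm_num
  have e2 : ∫ u in (0 : ℝ)..1, u ^ 2 * (1 - u) ^ 2 / 4 = 1 / 120 := by
    have e : (fun u : ℝ ↦ u ^ 2 * (1 - u) ^ 2 / 4) =
        fun u ↦ u ^ 2 * (1 / 4) - u ^ 3 * (1 / 2) + u ^ 4 * (1 / 4) := by
      ext u; ring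
    rw [e, intervalIntegral.integral_add (Continuous.intervalIntegrable (by fun_prop) _ _)
        (Continuous.intervalIntegrable (by fun_prop) _ _),
      intervalIntegral.integral_sub (Continuous.intervalIntegrable (by fun_prop) _ _)
        (Continuous.intervalIntegrable (by fun_prop) _ _)]
    simp only [intervalIntegral.integral_mul_const, integral_pow]
    norm_num
  rw [e1, e2]
  simp
  ring

lemma memLp_sub_smoothedPoisson (c : ℝ) : MemLp (fun x ↦ x - c) 2 (smoothedPoisson r) := by
  refine MemLp.sub ?_ (memLp_const c)
  rw [smoothedPoisson, memLp_map_measure_iff (by fun_prop) measurable_natCast_add.aemeasurable]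
  refine (memLp_fst_poissonUniform r).add (memLp_snd_poissonUniform r measurable_id (C := 1) ?_)
  intro u hu
  rw [id, abs_of_nonneg hu.1]
  exact hu.2.le

lemma integral_sub_smoothedPoisson : ∫ x, (x - ((r : ℝ) + 1 / 2)) ∂smoothedPoisson r = 0 := by
  rw [smoothedPoisson, integral_map measurable_natCast_add.aemeasurable (by fun_prop)]
  have h1 := integrable_fst_mul_snd_poissonUniform r (integrable_sub_poissonMeasure r)
    (continuous_const (y := (1 : ℝ)))
  have h2 := integrable_fst_mul_snd_poissonUniform r (integrable_const 1)
    (by fun_prop : Continuous fun u : ℝ ↦ u - 1 / 2)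
  have e : (fun z : ℕ × ℝ ↦ (z.1 : ℝ) + z.2 - ((r : ℝ) + 1 / 2)) =
      fun z ↦ ((z.1 : ℝ) - r) * 1 + 1 * (z.2 - 1 / 2) := by
    ext z; ring
  rw [e, integral_add h1 h2,
    integral_fst_mul_snd_poissonUniform r (fun n ↦ (n : ℝ) - r) (fun _ ↦ 1),
    integral_fst_mul_snd_poissonUniform r (fun _ ↦ 1) (fun u ↦ u - 1 / 2),
    integral_sub_poissonMeasure,
    intervalIntegral.integral_sub (Continuous.intervalIntegrable (by fun_prop) _ _)
      (Continuous.intervalIntegrable (by fun_prop) _ _), integral_id]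
  simp

lemma integral_sub_sq_smoothedPoisson :
    ∫ x, (x - ((r : ℝ) + 1 / 2)) ^ 2 ∂smoothedPoisson r = (r : ℝ) + 1 / 12 := by
  rw [smoothedPoisson, integral_map measurable_natCast_add.aemeasurable (by fun_prop)]
  have h1 := integrable_fst_mul_snd_poissonUniform r (integrable_sub_sq_poissonMeasure r)
    (continuous_const (y := (1 : ℝ)))
  have h2 := integrable_fst_mul_snd_poissonUniform r (integrable_sub_poissonMeasure r)
    (by fun_prop : Continuous fun u : ℝ ↦ 2 * u - 1)
  have h3 := integrable_fst_mul_snd_poissonUniform r (integrable_const 1)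
    (by fun_prop : Continuous fun u : ℝ ↦ (u - 1 / 2) ^ 2)
  have e : (fun z : ℕ × ℝ ↦ ((z.1 : ℝ) + z.2 - ((r : ℝ) + 1 / 2)) ^ 2) =
      fun z ↦ ((z.1 : ℝ) - r) ^ 2 * 1 + ((z.1 : ℝ) - r) * (2 * z.2 - 1) +
        1 * (z.2 - 1 / 2) ^ 2 := by
    ext z; ring
  rw [e, integral_add (h1.fun_add h2) h3, integral_add h1 h2,
    integral_fst_mul_snd_poissonUniform r (fun n ↦ ((n : ℝ) - r) ^ 2) (fun _ ↦ 1),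
    integral_fst_mul_snd_poissonUniform r (fun n ↦ (n : ℝ) - r) (fun u ↦ 2 * u - 1),
    integral_fst_mul_snd_poissonUniform r (fun _ ↦ 1) (fun u ↦ (u - 1 / 2) ^ 2),
    integral_sub_poissonMeasure, integral_sub_sq_poissonMeasure,
    intervalIntegral.integral_comp_sub_right (fun u ↦ u ^ 2) (1 / 2 : ℝ), integral_pow]
  simp
  norm_num

end Moments

/-! ### Gaussian moments and their transfer through the transport -/

section GaussianMoments

variable {v : ℝ≥0} (hv : v ≠ 0)

lemma integral_sq_gaussianReal (v : ℝ≥0) : ∫ y, y ^ 2 ∂gaussianReal 0 v = v := by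
  have h := variance_fun_id_gaussianReal (μ := 0) (v := v)
  rw [variance_eq_integral (by fun_prop), integral_id_gaussianReal] at h
  simpa using h

include hv in
-- The function -v φ is an antiderivative of z φ(z): the Stein kernel of the normal law is the
-- constant v.
lemma setIntegral_Ioi_gaussianReal (y : ℝ) :
    ∫ z in Set.Ioi y, z ∂gaussianReal 0 v = v * gaussianPDFReal 0 v y := by
  have hi : Integrable (fun z ↦ gaussianPDFReal 0 v z * z) := by
    have h := (memLp_id_gaussianReal (μ := 0) (v := v) 1).integrable le_rfl
    rw [gaussianReal_of_var_ne_zero _ hv, integrable_withDensity_iff_integrable_smul'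
      (measurable_gaussianPDF _ _) (ae_of_all _ fun _ ↦ gaussianPDF_lt_top)] at h
    simpa [toReal_gaussianPDF] using h
  rw [gaussianReal_of_var_ne_zero _ hv, setIntegral_withDensity_eq_setIntegral_toReal_smul
    (measurable_gaussianPDF _ _) (ae_of_all _ fun _ ↦ gaussianPDF_lt_top) _ measurableSet_Ioi]
  simp only [toReal_gaussianPDF, smul_eq_mul]
  have hv' : (v : ℝ) ≠ 0 := by exact_mod_cast hv
  rw [integral_Ioi_of_hasDerivAt_of_tendsto' (f := fun z ↦ -(v * gaussianPDFReal 0 v z)) (m := 0)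
    _ hi.integrableOn]
  · ring
  · simpa using ((tendsto_gaussianPDFReal_atTop hv).const_mul (v : ℝ)).neg
  · intro z _
    convert! ((hasDerivAt_gaussianPDFReal hv z).const_mul (v : ℝ)).neg using 1
    field_simp

end GaussianMoments

section TransportMoments

variable {r : ℝ≥0} (hr : 0 < r)
include hr

lemma memLp_gaussianTransport : MemLp (gaussianTransport r) 2 (smoothedPoisson r) := by
  have h := memLp_id_gaussianReal (μ := 0) (v := r) 2
  rw [← map_gaussianTransport hr,
    memLp_map_measure_iff (by fun_prop) (aemeasurable_gaussianTransport hr)] at h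
  exact h

lemma integral_gaussianTransport : ∫ x, gaussianTransport r x ∂smoothedPoisson r = 0 := by
  rw [← integral_map (f := fun y ↦ y) (aemeasurable_gaussianTransport hr) (by fun_prop),
    map_gaussianTransport hr, integral_id_gaussianReal]

lemma integral_gaussianTransport_sq :
    ∫ x, gaussianTransport r x ^ 2 ∂smoothedPoisson r = r := by
  rw [← integral_map (f := fun y ↦ y ^ 2) (aemeasurable_gaussianTransport hr) (by fun_prop),
    map_gaussianTransport hr, integral_sq_gaussianReal]

lemma setIntegral_Ioi_gaussianTransport {x : ℝ} (hx : 0 < x) :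
    ∫ t in Set.Ioi x, gaussianTransport r t ∂smoothedPoisson r =
      r * gaussianPDFReal 0 r (gaussianTransport r x) := by
  rw [← setIntegral_Ioi_gaussianReal hr.ne', ← map_gaussianTransport hr,
    setIntegral_map measurableSet_Ioi (by fun_prop) (aemeasurable_gaussianTransport hr)]
  refine setIntegral_congr_set ?_
  filter_upwards [ae_pos_smoothedPoisson r] with t ht
  exact propext ((strictMonoOn_gaussianTransport hr).lt_iff_lt hx ht).symm

end TransportMoments

/-! ### The Stein kernel on the real line -/

/-- The Stein kernel of `smoothedPoisson r`. -/
noncomputable def smoothedPoissonKernel (r : ℝ≥0) (x : ℝ) : ℝ :=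
  poissonUniformKernel r (⌊x⌋₊, x - ⌊x⌋₊)

lemma smoothedPoissonKernel_natCast_add (r : ℝ≥0) {z : ℕ × ℝ} (hz : z.2 ∈ Set.Ico (0 : ℝ) 1) :
    smoothedPoissonKernel r (z.1 + z.2) = poissonUniformKernel r z := by
  have h : ⌊(z.1 : ℝ) + z.2⌋₊ = z.1 := by
    exact (Nat.floor_eq_iff (add_nonneg (Nat.cast_nonneg _) hz.1)).2
      ⟨by linarith [hz.1], by linarith [hz.2]⟩
  rw [smoothedPoissonKernel, h, add_sub_cancel_left]

lemma smoothedPoissonKernel_nonneg (r : ℝ≥0) {x : ℝ} (hx : 0 ≤ x) :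
    0 ≤ smoothedPoissonKernel r x := by
  have h1 : 0 ≤ x - ⌊x⌋₊ := sub_nonneg.2 (Nat.floor_le hx)
  have h2 : 0 ≤ 1 - (x - ⌊x⌋₊) := by linarith [Nat.lt_floor_add_one x]
  simp only [smoothedPoissonKernel, poissonUniformKernel]
  positivity

lemma measurable_smoothedPoissonKernel (r : ℝ≥0) : Measurable (smoothedPoissonKernel r) := by
  have h : Measurable fun x : ℝ ↦ ((⌊x⌋₊ : ℕ) : ℝ) :=
    (Measurable.of_discrete (f := fun n : ℕ ↦ (n : ℝ))).comp Nat.measurable_floor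
  unfold smoothedPoissonKernel poissonUniformKernel
  fun_prop

lemma primitive_poissonWeight_add (r : ℝ≥0) (n : ℕ) {s : ℝ} (hs0 : 0 ≤ s) (hs1 : s ≤ 1) :
    ∫ t in (0 : ℝ)..n + s, poissonWeight r ⌊t⌋₊ * (t - (r + 1 / 2)) =
      (∫ t in (0 : ℝ)..n, poissonWeight r ⌊t⌋₊ * (t - (r + 1 / 2))) +
        poissonWeight r n * (n * s + s ^ 2 / 2 - (r + 1 / 2) * s) := by
  have hi := intervalIntegrable_poissonWeight_floor_mul r
    (by fun_prop : Continuous fun t : ℝ ↦ t - (r + 1 / 2))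
  rw [← intervalIntegral.integral_add_adjacent_intervals (hi 0 n) (hi n (n + s))]
  congr 1
  have e : ∫ t in (n : ℝ)..n + s, poissonWeight r ⌊t⌋₊ * (t - (r + 1 / 2)) =
      ∫ t in (n : ℝ)..n + s, poissonWeight r n * (t - (r + 1 / 2)) := by
    rw [intervalIntegral.integral_of_le (by linarith), intervalIntegral.integral_of_le (by linarith),
      integral_Ioc_eq_integral_Ioo, integral_Ioc_eq_integral_Ioo]
    refine setIntegral_congr_fun measurableSet_Ioo fun t ht ↦ ?_
    have : ⌊t⌋₊ = n := (Nat.floor_eq_iff ((Nat.cast_nonneg n).trans ht.1.le)).2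
      ⟨ht.1.le, ht.2.trans_le (by linarith)⟩
    simp only [this]
  rw [e, intervalIntegral.integral_const_mul,
    intervalIntegral.integral_comp_sub_right (fun t ↦ t) ((r : ℝ) + 1 / 2), integral_id]
  ring

/-- The cell [n, n + 1] contributes (n - r) w(n), which telescopes because (n + 1) w(n + 1) = r
w(n). -/
lemma primitive_poissonWeight_natCast (r : ℝ≥0) (n : ℕ) :
    ∫ t in (0 : ℝ)..n, poissonWeight r ⌊t⌋₊ * (t - (r + 1 / 2)) = -(n * poissonWeight r n) := by
  induction n with
  | zero => simp
  | succ n ih =>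
    rw [Nat.cast_add_one, primitive_poissonWeight_add r n zero_le_one le_rfl, ih,
      succ_mul_poissonWeight_succ]
    ring

/-- The Stein kernel times the density is an antiderivative of the (negative of the) centered
variable times the density. -/
lemma primitive_poissonWeight (r : ℝ≥0) {x : ℝ} (hx : 0 ≤ x) :
    ∫ t in (0 : ℝ)..x, poissonWeight r ⌊t⌋₊ * (t - (r + 1 / 2)) =
      -(poissonWeight r ⌊x⌋₊ * smoothedPoissonKernel r x) := by
  have h := primitive_poissonWeight_add r ⌊x⌋₊ (s := x - ⌊x⌋₊)
    (sub_nonneg.2 (Nat.floor_le hx)) (by linarith [Nat.lt_floor_add_one x])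
  rw [primitive_poissonWeight_natCast, add_sub_cancel] at h
  rw [h, smoothedPoissonKernel, poissonUniformKernel]
  ring

/-! ### The pointwise lower bound and its expectation -/

/-- A lower bound, uniform in `s > 0`, for `s * τ + r / s` (see `kernelCost_le`). -/
noncomputable def kernelCost (r τ : ℝ) : ℝ := r + τ - (τ - r) ^ 2 / r

/-- With q = τ / r, the arithmetic-geometric inequality bounds the right side below by 2 r √q. The
left side is r (3 q - q²), and for p = √q one has 2 - 3 p + p³ = (p - 1)² (p + 2) ≥ 0. Being
quadratic in τ, the bound needs only two moments of τ. -/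
lemma kernelCost_le {r τ s : ℝ} (hr : 0 < r) (hτ : 0 ≤ τ) (hs : 0 < s) :
    kernelCost r τ ≤ s * τ + r / s := by
  obtain ⟨q, rfl⟩ : ∃ q, τ = r * q := ⟨τ / r, by field_simp⟩
  have hq : 0 ≤ q := nonneg_of_mul_nonneg_right hτ hr
  have key : 0 ≤ q * s ^ 2 + 1 - s * (3 * q - q ^ 2) := by
    rcases le_or_gt q 3 with h | h
    · nlinarith [sq_nonneg (s * q - 1), sq_nonneg (s - 1), sq_nonneg (q - 1),
        mul_nonneg hq (sq_nonneg (2 * s - 3 + q)), mul_nonneg hq (sub_nonneg.2 h),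
        mul_nonneg (sub_nonneg.2 h) (sq_nonneg (q - 1))]
    · have : s * (3 * q - q ^ 2) ≤ 0 :=
        mul_nonpos_of_nonneg_of_nonpos hs.le (by nlinarith)
      nlinarith [mul_nonneg hq (sq_nonneg s)]
  have e : s * (r * q) + r / s - kernelCost r (r * q) =
      r / s * (q * s ^ 2 + 1 - s * (3 * q - q ^ 2)) := by
    unfold kernelCost
    field_simp
    ring
  rw [← sub_nonneg, e]
  positivity

section Cost

variable (r : ℝ≥0)

lemma kernelCost_smoothedPoissonKernel_comp :
    (fun z : ℕ × ℝ ↦ kernelCost r (smoothedPoissonKernel r (z.1 + z.2))) =ᵐ[poissonUniform r]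
      fun z ↦ 2 * r + (poissonUniformKernel r z - r) - (poissonUniformKernel r z - r) ^ 2 / r := by
  filter_upwards [ae_snd_mem_Ico_poissonUniform r] with z hz
  rw [smoothedPoissonKernel_natCast_add r hz, kernelCost]
  ring

lemma measurable_kernelCost : Measurable fun x ↦ kernelCost r (smoothedPoissonKernel r x) := by
  have := measurable_smoothedPoissonKernel r
  unfold kernelCost
  fun_prop

lemma integrable_kernelCost :
    Integrable (fun x ↦ kernelCost r (smoothedPoissonKernel r x)) (smoothedPoisson r) := by
  rw [smoothedPoisson, integrable_map_measure (measurable_kernelCost r).aestronglyMeasurable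
    measurable_natCast_add.aemeasurable]
  refine Integrable.congr ?_ (kernelCost_smoothedPoissonKernel_comp r).symm
  exact ((integrable_const _).add (integrable_poissonUniformKernel_sub r)).sub
    ((integrable_poissonUniformKernel_sub_sq r).div_const _)

lemma integral_kernelCost (hr : 0 < r) :
    ∫ x, kernelCost r (smoothedPoissonKernel r x) ∂smoothedPoisson r =
      2 * r + 1 / 12 - (1 / 3 + 1 / (120 * r)) := by
  have hr' : (r : ℝ) ≠ 0 := by exact_mod_cast hr.ne'
  have h1 : Integrable (fun z ↦ 2 * (r : ℝ) + (poissonUniformKernel r z - r)) (poissonUniform r) :=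
    (integrable_const _).add (integrable_poissonUniformKernel_sub r)
  rw [smoothedPoisson, integral_map measurable_natCast_add.aemeasurable
    (measurable_kernelCost r).aestronglyMeasurable,
    integral_congr_ae (kernelCost_smoothedPoissonKernel_comp r),
    integral_sub h1 ((integrable_poissonUniformKernel_sub_sq r).div_const _),
    integral_add (integrable_const _) (integrable_poissonUniformKernel_sub r), integral_div,
    integral_poissonUniformKernel_sub, integral_poissonUniformKernel_sub_sq]
  simp
  field_simp

lemma integrable_poissonWeight_mul {g : ℝ → ℝ} (hg : Integrable g (smoothedPoisson r)) :
    IntegrableOn (fun x ↦ poissonWeight r ⌊x⌋₊ * g x) (Set.Ici 0) := by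
  rw [smoothedPoisson_eq_withDensity, integrable_withDensity_iff_integrable_smul'
    (measurable_poissonWeight_floor r).ennreal_ofReal (by simp)] at hg
  simpa [IntegrableOn, ENNReal.toReal_ofReal (poissonWeight_nonneg _ _)] using hg

end Cost

/-- W - c has mean zero, so its lower and upper partial integrals are opposite. -/
lemma primitive_eq_neg_setIntegral_Ioi (r : ℝ≥0) {x : ℝ} (hx : 0 ≤ x) :
    ∫ t in (0 : ℝ)..x, poissonWeight r ⌊t⌋₊ * (t - (r + 1 / 2)) =
      -∫ t in Set.Ioi x, (t - (r + 1 / 2)) ∂smoothedPoisson r := by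
  have hi := (memLp_sub_smoothedPoisson r ((r : ℝ) + 1 / 2)).integrable one_le_two
  have h := integral_add_compl (measurableSet_Ioi (a := x)) hi
  rw [integral_sub_smoothedPoisson, Set.compl_Ioi] at h
  rw [← setIntegral_smoothedPoisson r le_rfl hx, ← eq_neg_of_add_eq_zero_right h]
  refine setIntegral_congr_set ?_
  filter_upwards [ae_pos_smoothedPoisson r] with t ht
  exact propext ⟨fun h ↦ h.2, fun h ↦ ⟨ht, h⟩⟩

/-! ### Lower bound for the covariance of W and T(W) -/

section Main

variable {r : ℝ≥0} (hr : 0 < r)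
include hr

lemma integrable_gaussianTransport_mul (c : ℝ) :
    Integrable (fun x ↦ gaussianTransport r x * (x - c)) (smoothedPoisson r) :=
  (memLp_gaussianTransport hr).integrable_mul (memLp_sub_smoothedPoisson r c)

/-- The function whose increments are compared with `2 E T(W) (W - E W)`. -/
noncomputable def transportPotential (r : ℝ≥0) (x : ℝ) : ℝ :=
  gaussianTransport r x * (∫ t in (0 : ℝ)..x, poissonWeight r ⌊t⌋₊ * (t - (r + 1 / 2))) -
    r * ((x - (r + 1 / 2)) * gaussianPDFReal 0 r (gaussianTransport r x))

/-- Both integrations by parts in differential form. By φ' = -(T / r) φ at T and φ(T) T' = w, each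
of the two products contributes one copy of w T (x - c); the remainders are -w τ T' and -r φ(T) = -w
r / T'. -/
lemma hasDerivWithinAt_transportPotential {x : ℝ} (hx : 0 < x) :
    HasDerivWithinAt (transportPotential r)
      (poissonWeight r ⌊x⌋₊ * (2 * (gaussianTransport r x * (x - (r + 1 / 2))) -
        (poissonWeight r ⌊x⌋₊ / gaussianPDFReal 0 r (gaussianTransport r x) *
          smoothedPoissonKernel r x +
        r / (poissonWeight r ⌊x⌋₊ / gaussianPDFReal 0 r (gaussianTransport r x)))))
      (Set.Ioi x) x := by
  have hw := poissonWeight_pos hr ⌊x⌋₊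
  have hφ := gaussianPDFReal_pos 0 r (gaussianTransport r x) hr.ne'
  have hr' : (0 : ℝ) < r := hr
  have hT := hasDerivWithinAt_gaussianTransport hr hx
  have hH := hasDerivWithinAt_primitive_poissonWeight r
    (by fun_prop : Continuous fun t : ℝ ↦ t - (r + 1 / 2)) hx.le
  have hP := (hasDerivAt_gaussianPDFReal hr.ne' (gaussianTransport r x)).comp_hasDerivWithinAt x hT
  have hI := (hasDerivWithinAt_id x (Set.Ioi x)).sub_const ((r : ℝ) + 1 / 2)
  convert! (hT.mul hH).sub ((hI.mul hP).const_mul (r : ℝ)) using 1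
  rw [primitive_poissonWeight r hx.le]
  simp only [id, Function.comp]
  field_simp
  ring

lemma sub_transportPotential_le {a b : ℝ} (ha : 0 < a) (hab : a ≤ b) :
    transportPotential r b - transportPotential r a ≤
      ∫ x in Set.Ioc a b, (2 * (gaussianTransport r x * (x - (r + 1 / 2))) -
        kernelCost r (smoothedPoissonKernel r x)) ∂smoothedPoisson r := by
  rw [setIntegral_smoothedPoisson r ha.le hab]
  have hsub : Set.Icc a b ⊆ Set.Ioi 0 := fun x hx ↦ ha.trans_le hx.1
  refine intervalIntegral.sub_le_integral_of_hasDeriv_right_of_le hab ?_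
    (fun x hx ↦ hasDerivWithinAt_transportPotential hr (ha.trans hx.1)) ?_ ?_
  · have hT := (continuousOn_gaussianTransport hr).mono hsub
    refine (hT.mul (continuous_primitive_poissonWeight r (by fun_prop)).continuousOn).sub
      (continuousOn_const.mul (ContinuousOn.mul (by fun_prop)
        ((continuous_gaussianPDFReal hr.ne').comp_continuousOn hT)))
  · exact (integrable_poissonWeight_mul r (((integrable_gaussianTransport_mul hr _).const_mul 2).sub
      (integrable_kernelCost r))).mono_set (hsub.trans Set.Ioi_subset_Ici_self)
  · intro x hx
    have hx0 := ha.trans hx.1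
    refine mul_le_mul_of_nonneg_left (sub_le_sub_left ?_ _) (poissonWeight_nonneg _ _)
    exact kernelCost_le hr (smoothedPoissonKernel_nonneg r hx0.le)
      (div_pos (poissonWeight_pos hr _) (gaussianPDFReal_pos _ _ _ hr.ne'))

/-- Beyond b both factors T(t) and t - c are nonnegative and increasing. Freezing either one at b
decreases the tail integral of the product, and the two frozen integrals are exactly the two terms
of the boundary value, up to sign. -/
lemma neg_le_transportPotential {b : ℝ} (hb : 0 < b) (hbr : r + 1 / 2 ≤ b)
    (hT : 0 ≤ gaussianTransport r b) :
    -(2 * ∫ t in Set.Ioi b, gaussianTransport r t * (t - (r + 1 / 2)) ∂smoothedPoisson r) ≤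
      transportPotential r b := by
  have hi := (memLp_sub_smoothedPoisson r ((r : ℝ) + 1 / 2)).integrable one_le_two
  have hiT := (memLp_gaussianTransport hr).integrable one_le_two
  have hiM := integrable_gaussianTransport_mul hr ((r : ℝ) + 1 / 2)
  have hmono : ∀ t ∈ Set.Ioi b, gaussianTransport r b ≤ gaussianTransport r t := fun t ht ↦
    (strictMonoOn_gaussianTransport hr).monotoneOn hb (hb.trans ht) (Set.mem_Ioi.1 ht).le
  have h1 : gaussianTransport r b * ∫ t in Set.Ioi b, (t - (r + 1 / 2)) ∂smoothedPoisson r ≤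
      ∫ t in Set.Ioi b, gaussianTransport r t * (t - (r + 1 / 2)) ∂smoothedPoisson r := by
    rw [← integral_const_mul]
    refine setIntegral_mono_on (hi.const_mul _).integrableOn hiM.integrableOn measurableSet_Ioi
      fun t ht ↦ mul_le_mul_of_nonneg_right (hmono t ht) ?_
    linarith [Set.mem_Ioi.1 ht]
  have h2 : (b - (r + 1 / 2)) * ∫ t in Set.Ioi b, gaussianTransport r t ∂smoothedPoisson r ≤
      ∫ t in Set.Ioi b, gaussianTransport r t * (t - (r + 1 / 2)) ∂smoothedPoisson r := by
    rw [← integral_const_mul]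
    refine setIntegral_mono_on (hiT.const_mul _).integrableOn hiM.integrableOn measurableSet_Ioi
      fun t ht ↦ ?_
    rw [mul_comm]
    refine mul_le_mul_of_nonneg_left ?_ (hT.trans (hmono t ht))
    linarith [Set.mem_Ioi.1 ht]
  rw [setIntegral_Ioi_gaussianTransport hr hb] at h2
  rw [transportPotential, primitive_eq_neg_setIntegral_Ioi r hb.le]
  linarith

/-- The mirror image at the lower end: both factors are nonpositive there, and E T(W) = 0 turns the
lower partial integral of T into -r φ(T(a)). -/
lemma transportPotential_le {a : ℝ} (ha : 0 < a) (har : a ≤ r + 1 / 2)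
    (hT : gaussianTransport r a ≤ 0) :
    transportPotential r a ≤
      2 * ∫ t in Set.Iic a, gaussianTransport r t * (t - (r + 1 / 2)) ∂smoothedPoisson r := by
  have hi := (memLp_sub_smoothedPoisson r ((r : ℝ) + 1 / 2)).integrable one_le_two
  have hiT := (memLp_gaussianTransport hr).integrable one_le_two
  have hiM := integrable_gaussianTransport_mul hr ((r : ℝ) + 1 / 2)
  have hmono : ∀ t ∈ Set.Ioc 0 a, gaussianTransport r t ≤ gaussianTransport r a := fun t ht ↦
    (strictMonoOn_gaussianTransport hr).monotoneOn ht.1 ha ht.2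
  have hset : (Set.Iic a : Set ℝ) =ᵐ[smoothedPoisson r] (Set.Ioc 0 a : Set ℝ) := by
    filter_upwards [ae_pos_smoothedPoisson r] with t ht
    exact propext ⟨fun h ↦ ⟨ht, h⟩, fun h ↦ h.2⟩
  have h1 : gaussianTransport r a * ∫ t in Set.Ioc 0 a, (t - (r + 1 / 2)) ∂smoothedPoisson r ≤
      ∫ t in Set.Ioc 0 a, gaussianTransport r t * (t - (r + 1 / 2)) ∂smoothedPoisson r := by
    rw [← integral_const_mul]
    refine setIntegral_mono_on (hi.const_mul _).integrableOn hiM.integrableOn measurableSet_Ioc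
      fun t ht ↦ mul_le_mul_of_nonpos_right (hmono t ht) ?_
    linarith [ht.2]
  have h2 : (a - (r + 1 / 2)) * ∫ t in Set.Ioc 0 a, gaussianTransport r t ∂smoothedPoisson r ≤
      ∫ t in Set.Ioc 0 a, gaussianTransport r t * (t - (r + 1 / 2)) ∂smoothedPoisson r := by
    rw [← integral_const_mul]
    refine setIntegral_mono_on (hiT.const_mul _).integrableOn hiM.integrableOn measurableSet_Ioc
      fun t ht ↦ ?_
    rw [mul_comm]
    refine mul_le_mul_of_nonpos_left ?_ ((hmono t ht).trans hT)
    linarith [ht.2]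
  have h3 := integral_add_compl (measurableSet_Ioi (a := a)) hiT
  rw [integral_gaussianTransport hr, Set.compl_Ioi, setIntegral_congr_set hset,
    setIntegral_Ioi_gaussianTransport hr ha] at h3
  rw [eq_neg_of_add_eq_zero_right h3] at h2
  rw [transportPotential, setIntegral_congr_set hset, ← setIntegral_smoothedPoisson r le_rfl ha.le]
  linarith

lemma setIntegral_kernelCost_le {a b : ℝ} (ha : 0 < a) (har : a ≤ r + 1 / 2)
    (hTa : gaussianTransport r a ≤ 0) (hbr : r + 1 / 2 ≤ b) (hTb : 0 ≤ gaussianTransport r b) :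
    ∫ x in Set.Ioc a b, kernelCost r (smoothedPoissonKernel r x) ∂smoothedPoisson r ≤
      2 * ∫ x, gaussianTransport r x * (x - (r + 1 / 2)) ∂smoothedPoisson r := by
  have hab := har.trans hbr
  have hiM := integrable_gaussianTransport_mul hr ((r : ℝ) + 1 / 2)
  have h := sub_transportPotential_le hr ha hab
  rw [integral_sub (hiM.const_mul 2).integrableOn (integrable_kernelCost r).integrableOn,
    integral_const_mul] at h
  have h1 := integral_add_compl (measurableSet_Ioi (a := b)) hiM
  have h2 := setIntegral_union (Set.Iic_disjoint_Ioc (le_refl a)) (measurableSet_Ioc (b := b))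
    hiM.integrableOn hiM.integrableOn
  rw [Set.Iic_union_Ioc_eq_Iic hab] at h2
  rw [Set.compl_Ioi, h2] at h1
  have h3 := neg_le_transportPotential hr (ha.trans_le hab) hbr hTb
  have h4 := transportPotential_le hr ha har hTa
  linarith

lemma integral_kernelCost_le :
    ∫ x, kernelCost r (smoothedPoissonKernel r x) ∂smoothedPoisson r ≤
      2 * ∫ x, gaussianTransport r x * (x - (r + 1 / 2)) ∂smoothedPoisson r := by
  have ha : Filter.Tendsto (fun n : ℕ ↦ 1 / ((n : ℝ) + 1)) Filter.atTop (nhds 0) :=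
    tendsto_one_div_add_atTop_nhds_zero_nat
  have hb : Filter.Tendsto (fun n : ℕ ↦ (n : ℝ)) Filter.atTop Filter.atTop :=
    tendsto_natCast_atTop_atTop
  have hcover : AECover (smoothedPoisson r) Filter.atTop
      fun n : ℕ ↦ Set.Ioc (1 / ((n : ℝ) + 1)) (n : ℝ) := by
    refine ⟨?_, fun n ↦ measurableSet_Ioc⟩
    filter_upwards [ae_pos_smoothedPoisson r] with x hx
    filter_upwards [ha.eventually (gt_mem_nhds hx), hb.eventually (Filter.eventually_ge_atTop x)]
      with n h1 h2 using ⟨h1, h2⟩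
  refine le_of_tendsto (hcover.integral_tendsto_of_countably_generated (integrable_kernelCost r)) ?_
  -- Once the interval contains the zero of T, monotonicity gives the signs of T required at its
  -- ends.
  obtain ⟨x₀, hx₀, hT₀⟩ := exists_gaussianTransport_eq hr 0
  have hmono := (strictMonoOn_gaussianTransport hr).monotoneOn
  filter_upwards [ha.eventually (gt_mem_nhds hx₀),
    ha.eventually (gt_mem_nhds (by positivity : (0 : ℝ) < r + 1 / 2)),
    hb.eventually (Filter.eventually_ge_atTop x₀),
    hb.eventually (Filter.eventually_ge_atTop ((r : ℝ) + 1 / 2))] with n h1 h2 h3 h4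
  have hn : (0 : ℝ) < 1 / (n + 1) := by positivity
  refine setIntegral_kernelCost_le hr hn h2.le ?_ h4 ?_
  · rw [← hT₀]
    exact hmono hn hx₀ h1.le
  · rw [← hT₀]
    exact hmono hx₀ (hx₀.trans_le h3) h3

end Main

/-! ### Cost of the coupling -/

section Coupling

variable {r : ℝ≥0} (hr : 0 < r)
include hr

lemma memLp_gaussianTransport_natCast_add :
    MemLp (fun z : ℕ × ℝ ↦ gaussianTransport r (z.1 + z.2)) 2 (poissonUniform r) :=
  (memLp_gaussianTransport hr).comp_of_map measurable_natCast_add.aemeasurable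

lemma integral_sub_gaussianTransport_sq_le :
    ∫ x, (x - ((r : ℝ) + 1 / 2) - gaussianTransport r x) ^ 2 ∂smoothedPoisson r ≤
      (1 : ℝ) / 3 + 1 / (120 * r) := by
  have h1 := (memLp_sub_smoothedPoisson r ((r : ℝ) + 1 / 2)).integrable_sq
  have h2 := (memLp_gaussianTransport hr).integrable_sq
  have h3 := (integrable_gaussianTransport_mul hr ((r : ℝ) + 1 / 2)).const_mul 2
  have e : (fun x ↦ (x - (r + 1 / 2) - gaussianTransport r x) ^ 2) = fun x ↦
      (x - (r + 1 / 2)) ^ 2 + gaussianTransport r x ^ 2 -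
        2 * (gaussianTransport r x * (x - (r + 1 / 2))) := by
    ext x; ring
  have h := integral_kernelCost_le hr
  rw [integral_kernelCost r hr] at h
  rw [e, integral_sub (h1.fun_add h2) h3, integral_add h1 h2, integral_const_mul,
    integral_sub_sq_smoothedPoisson, integral_gaussianTransport_sq hr]
  linarith

lemma integrable_coupling_cost :
    Integrable (fun z : ℕ × ℝ ↦ ((z.1 : ℝ) - r - gaussianTransport r (z.1 + z.2)) ^ 2)
      (poissonUniform r) :=
  (((memLp_fst_poissonUniform r).sub (memLp_const (r : ℝ))).sub
    (memLp_gaussianTransport_natCast_add hr)).integrable_sq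

lemma integral_coupling_cost_le :
    ∫ z, ((z.1 : ℝ) - r - gaussianTransport r (z.1 + z.2)) ^ 2 ∂poissonUniform r ≤
      5 / 6 + 1 / (60 * r) := by
  have hm : MemLp (fun x ↦ x - ((r : ℝ) + 1 / 2) - gaussianTransport r x) 2 (smoothedPoisson r) :=
    (memLp_sub_smoothedPoisson r _).sub (memLp_gaussianTransport hr)
  have hW := integral_sub_gaussianTransport_sq_le hr
  rw [smoothedPoisson, integral_map measurable_natCast_add.aemeasurable
    hm.integrable_sq.aestronglyMeasurable] at hW
  have hU := integral_fst_mul_snd_poissonUniform r (fun _ ↦ 1) (fun u ↦ (u - 1 / 2) ^ 2)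
  rw [intervalIntegral.integral_comp_sub_right (fun u ↦ u ^ 2) (1 / 2 : ℝ), integral_pow] at hU
  have hUi := integrable_fst_mul_snd_poissonUniform r (integrable_const 1)
    (by fun_prop : Continuous fun u : ℝ ↦ (u - 1 / 2) ^ 2)
  simp only [one_mul] at hU hUi
  have hWi := (hm.comp_of_map measurable_natCast_add.aemeasurable).integrable_sq
  -- Here N - r - T(W) = (W - c - T(W)) - (U - 1/2), and (x - y)² ≤ 2 x² + 2 y².
  have hle := integral_mono (integrable_coupling_cost hr)
    ((hUi.const_mul 2).add (hWi.const_mul 2)) fun z ↦ by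
      simp only [Pi.add_apply, Function.comp]
      have := sq_nonneg (((z.1 : ℝ) + z.2 - (r + 1 / 2) - gaussianTransport r (z.1 + z.2)) +
        (z.2 - 1 / 2))
      nlinarith
  refine hle.trans ?_
  rw [integral_add' (hUi.const_mul 2) (hWi.const_mul 2), integral_const_mul, integral_const_mul, hU]
  simp only [Function.comp]
  have e : 1 / (60 * (r : ℝ)) = 2 * (1 / (120 * r)) := by
    have hr' : (r : ℝ) ≠ 0 := by exact_mod_cast hr.ne'
    field_simp
    norm_num
  rw [e]
  norm_num at hW ⊢
  linarith

lemma integral_gaussianTransport_natCast_add :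
    ∫ z, gaussianTransport r (z.1 + z.2) ∂poissonUniform r = 0 := by
  have h := integral_gaussianTransport hr
  rwa [smoothedPoisson, integral_map measurable_natCast_add.aemeasurable
    (memLp_gaussianTransport hr).aestronglyMeasurable] at h

lemma integral_gaussianTransport_natCast_add_sq :
    ∫ z, gaussianTransport r (z.1 + z.2) ^ 2 ∂poissonUniform r = r := by
  have h := integral_gaussianTransport_sq hr
  rwa [smoothedPoisson, integral_map measurable_natCast_add.aemeasurable
    (memLp_gaussianTransport hr).integrable_sq.aestronglyMeasurable] at h

/-- The coupling is nondecreasing, so that it does no worse than the independent one. -/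
lemma integral_coupling_cost_le_two_mul :
    ∫ z, ((z.1 : ℝ) - r - gaussianTransport r (z.1 + z.2)) ^ 2 ∂poissonUniform r ≤ 2 * r := by
  obtain ⟨x₀, hx₀, hT₀⟩ := exists_gaussianTransport_eq hr 0
  have hmono := (strictMonoOn_gaussianTransport hr).monotoneOn
  have hY := memLp_gaussianTransport_natCast_add hr
  have hX : MemLp (fun z : ℕ × ℝ ↦ (z.1 : ℝ) - r) 2 (poissonUniform r) :=
    (memLp_fst_poissonUniform r).sub (memLp_const (r : ℝ))
  have hY1 := hY.integrable one_le_two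
  have hY2 := hY.integrable_sq
  have hX2 := hX.integrable_sq
  have hEX : ∫ z : ℕ × ℝ, ((z.1 : ℝ) - r) ^ 2 ∂poissonUniform r = r := by
    have h := integral_fst_mul_snd_poissonUniform r (fun n ↦ ((n : ℝ) - r) ^ 2) (fun _ ↦ 1)
    rw [integral_sub_sq_poissonMeasure] at h
    simpa using h
  have hpos : ∀ᵐ z ∂poissonUniform r, 0 < (z.1 : ℝ) + z.2 :=
    ae_of_ae_map measurable_natCast_add.aemeasurable (ae_pos_smoothedPoisson r)
  -- As T(W) has mean zero, N may be recentered at ⌊x₀⌋ instead of r, with x₀ the zero of T. Then N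
  -- - ⌊x₀⌋ and T(W) never have opposite signs, so the cross term can be dropped; the correction
  -- proportional to T(W) integrates to 0.
  have hle := integral_mono_ae (integrable_coupling_cost hr)
    ((hX2.add hY2).add (hY1.const_mul (2 * ((r : ℝ) - ⌊x₀⌋₊)))) (by
      filter_upwards [hpos, ae_snd_mem_Ico_poissonUniform r] with z hz hu
      have hfl : ⌊(z.1 : ℝ) + z.2⌋₊ = z.1 :=
        (Nat.floor_eq_iff hz.le).2 ⟨by linarith [hu.1], by linarith [hu.2]⟩
      have key : 0 ≤ ((z.1 : ℝ) - ⌊x₀⌋₊) * gaussianTransport r (z.1 + z.2) := by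
        rcases le_total x₀ (z.1 + z.2) with h | h
        · refine mul_nonneg (sub_nonneg.2 ?_) (hT₀ ▸ hmono hx₀ hz h)
          exact_mod_cast hfl ▸ Nat.floor_mono h
        · refine mul_nonneg_of_nonpos_of_nonpos (sub_nonpos.2 ?_) (hT₀ ▸ hmono hz hx₀ h)
          exact_mod_cast hfl ▸ Nat.floor_mono h
      simp only [Pi.add_apply]
      nlinarith)
  refine hle.trans ?_
  rw [integral_add' (hX2.add hY2) (hY1.const_mul _), integral_add' hX2 hY2, integral_const_mul,
    integral_gaussianTransport_natCast_add hr, integral_gaussianTransport_natCast_add_sq hr, hEX]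
  linarith

/-- The threshold 0.4 is one convenient choice: below it 2 r ≤ 0.8, above it 5/6 + 1/(60 r) ≤ 0.875.
-/
lemma integral_coupling_cost_le_const :
    ∫ z, ((z.1 : ℝ) - r - gaussianTransport r (z.1 + z.2)) ^ 2 ∂poissonUniform r ≤ 0.937 := by
  rcases le_total (r : ℝ) 0.4 with h | h
  · refine (integral_coupling_cost_le_two_mul hr).trans ?_
    linarith
  · refine (integral_coupling_cost_le hr).trans ?_
    have : 1 / (60 * (r : ℝ)) ≤ 1 / (60 * 0.4) := by gcongr
    norm_num at this ⊢
    linarith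

lemma map_gaussianTransport_natCast_add :
    (poissonUniform r).map (fun z ↦ gaussianTransport r (z.1 + z.2)) = gaussianReal 0 r := by
  rw [← map_gaussianTransport hr, smoothedPoisson,
    AEMeasurable.map_map_of_aemeasurable (aemeasurable_gaussianTransport hr)
      measurable_natCast_add.aemeasurable]
  rfl

lemma aemeasurable_gaussianTransport_natCast_add :
    AEMeasurable (fun z : ℕ × ℝ ↦ gaussianTransport r (z.1 + z.2)) (poissonUniform r) :=
  (memLp_gaussianTransport_natCast_add hr).aestronglyMeasurable.aemeasurable

lemma transportCost_sq_le (α : ℝ) :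
    transportCost (fun x ↦ |x| ^ (2 : ℝ))
      ((poissonMeasure r).map fun n : ℕ ↦ α * ((n : ℝ) - r))
      ((gaussianReal 0 r).map fun y ↦ α * y) ≤ ENNReal.ofReal (0.937 * α ^ 2) := by
  have hY := aemeasurable_gaussianTransport_natCast_add hr
  have hX : AEMeasurable (fun z : ℕ × ℝ ↦ α * ((z.1 : ℝ) - r)) (poissonUniform r) := by fun_prop
  have hXY := hX.prodMk (hY.const_mul α)
  refine (iInf₂_le ((poissonUniform r).map fun z ↦
    (α * ((z.1 : ℝ) - r), α * gaussianTransport r (z.1 + z.2))) ⟨?_, ?_⟩).trans ?_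
  · rw [lintegral_map' (by fun_prop) hXY]
    have e : ∀ z : ℕ × ℝ, |α * ((z.1 : ℝ) - r) - α * gaussianTransport r (z.1 + z.2)| ^ (2 : ℝ) =
        α ^ 2 * ((z.1 : ℝ) - r - gaussianTransport r (z.1 + z.2)) ^ 2 := fun z ↦ by
      rw [Real.rpow_two, sq_abs]
      ring
    simp only [e]
    rw [← ofReal_integral_eq_lintegral_ofReal ((integrable_coupling_cost hr).const_mul _)
      (ae_of_all _ fun z ↦ by positivity), integral_const_mul, mul_comm]
    exact ENNReal.ofReal_le_ofReal
      (mul_le_mul_of_nonneg_right (integral_coupling_cost_le_const hr) (sq_nonneg _))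
  · rw [AEMeasurable.map_map_of_aemeasurable measurable_fst.aemeasurable hXY,
      ← Measure.fst_prod (μ := poissonMeasure r) (ν := volume.restrict (Set.Ico (0 : ℝ) 1)),
      Measure.fst, Measure.map_map .of_discrete measurable_fst]
    rfl
  · rw [AEMeasurable.map_map_of_aemeasurable measurable_snd.aemeasurable hXY,
      ← map_gaussianTransport_natCast_add hr,
      AEMeasurable.map_map_of_aemeasurable (by fun_prop) hY]
    rfl

end Coupling

/-! ### Conclusion for the Poisson process -/

lemma wassersteinDist_two_sq (μ ν : Measure ℝ) :
    wassersteinDist 2 μ ν ^ 2 = transportCost (fun x ↦ |x| ^ (2 : ℝ)) μ ν := by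
  rw [wassersteinDist, ← ENNReal.rpow_natCast, ← ENNReal.rpow_mul]
  norm_num

lemma IsPoissonProcess.hasLaw {Ω : Type*} [MeasurableSpace Ω] {r : ℝ≥0} {N : ℝ≥0 → Ω → ℕ}
    {P : Measure Ω} (hN : IsPoissonProcess r N P) (t : ℝ≥0) :
    HasLaw (N t) (poissonMeasure (r * t)) P := by
  have h := hN.law 0 t zero_le
  rw [tsub_zero] at h
  refine h.congr ?_
  filter_upwards [hN.zero] with ω hω
  rw [hω, Nat.sub_zero]

theorem proposition3p1 {Ω : Type*} [MeasurableSpace Ω] (P : Measure Ω) [IsProbabilityMeasure P]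
    (N : ℝ≥0 → Ω → ℕ) (hN : IsPoissonProcess 1 N P) (m α : ℝ) (hm : 0 < m) (hα : α ≠ 0) :
    wassersteinDist 2
        (P.map fun ω ↦ α * ((N (m / α ^ 2).toNNReal ω : ℝ) - m / α ^ 2))
        (gaussianReal 0 m.toNNReal) ^ 2
      ≤ ENNReal.ofReal (0.937 * α ^ 2) := by
  have hpos : 0 < m / α ^ 2 := by positivity
  set r : ℝ≥0 := (m / α ^ 2).toNNReal with hr_def
  have hr : 0 < r := Real.toNNReal_pos.2 hpos
  have hrm : (r : ℝ) = m / α ^ 2 := Real.coe_toNNReal _ hpos.le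
  have hlaw := hN.hasLaw r
  rw [one_mul] at hlaw
  have h1 : (P.map fun ω ↦ α * ((N r ω : ℝ) - m / α ^ 2)) =
      (poissonMeasure r).map fun n : ℕ ↦ α * ((n : ℝ) - r) := by
    rw [← hlaw.map_eq, AEMeasurable.map_map_of_aemeasurable .of_discrete hlaw.aemeasurable, hrm]
    rfl
  have h2 : gaussianReal 0 m.toNNReal = (gaussianReal 0 r).map fun y ↦ α * y := by
    rw [gaussianReal_map_const_mul, mul_zero]
    congr 1
    ext
    rw [NNReal.coe_mul, hrm, Real.coe_toNNReal _ hm.le, NNReal.coe_mk]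
    field_simp
  rw [wassersteinDist_two_sq, h1, h2]
  exact transportCost_sq_le hr α
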